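/- Let $L$ be an oriented link with any number $\mu\ge 1$ of components. Let $\Delta_L$ be its Alexander polynomial with one variable $t_i$ for each component, defined up to multiplication by $\pm t_1^{a_1}\cdots t_\mu^{a_\mu}$: if $\mu=1$, it is the determinant of the Alexander matrix of a diagram of $L$ with one row and one column deleted; if $\mu\ge 2$, it is such a determinant divided by $t_i-1$, where $i$ is the component of the arc whose column is deleted. Let $\Delta_L^0(t)\in\mathbb{Z}[t]$ be the reduced Alexander polynomial, obtained from $\Delta_L$ by setting $t_1=\dots=t_\mu=t$ and multiplying by a unit $\pm t^a$ so that the constant term is positive (if the polynomial is nonzero). For a prime $p$ and an integer $m$ with $\gcd(m,p)=1$, a $(p,m)$-coloring of a diagram is a coloring of its arcs by the linear Alexander quandle $\Lambda_{p,m}$, that is $\mathbb{Z}/p$ with $x*y=mx+(1-m)y$: at a crossing with over-arc colored $y$, incoming under-arc colored $x$ and outgoing under-arc colored $z$, one has $z=x*y$ if the crossing is positive and $x=z*y$ if it is negative. It is nontrivial if it is not constant. If $L$ admits nontrivial $(p,m)$-colorings, let $\mathrm{mincol}_{p,m}(L)$ be the minimum number of colors used by a nontrivial $(p,m)$-coloring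 of a diagram of $L$, over all diagrams of $L$. **Theorem.** Suppose that $\Delta_L^0\neq 0$. Let $m$ be an integer with $\Delta_L^0(m)\neq 0$, and let $p$ be a prime factor of $\Delta_L^0(m)$ with $\gcd(m,p)=1$ such that $L$ admits nontrivial $(p,m)$-colorings. Suppose that $m\neq 1$ and $m\neq 1-p$. Then $$2+\lfloor \log_M p\rfloor\le \mathrm{mincol}_{p,m}(L),\qquad M=\max\{|m|,|m-1|\}.$$ -/

import Mathlib

open scoped Polynomial

noncomputable section

/-!
Oriented links in the 3-sphere are treated combinatorially: a link is a class of oriented planar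
link diagrams modulo the Reidemeister moves.
-/

namespace LinkTheory

/-- A crossing of a diagram whose strands carry `n` marked points: the marked point at which the
over-strand passes, the one at which the under-strand passes, and the sign of the crossing. The
sign is `1` if the under-strand crosses the over-strand from its right to its left, else `-1`. -/
structure Crossing (n : ℕ) where
  top : Fin n
  bot : Fin n
  sign : ℤˣ
deriving DecidableEq

/-- A signed oriented Gauss code. Marked points `Fin n` lie on closed oriented strands, and `next`
sends a point to the following one on its strand, so each component of the link is a cycle of
`next`. Some points are paired to crossings; the other ones (plain points) are 2-valent vertices,
which also make it possible to have components without crossings. The edge from `x` to `next x`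
is named by its starting point `x`. -/
structure GaussCode (n : ℕ) where
  next : Equiv.Perm (Fin n)
  crossings : Finset (Crossing n)
  top_ne_bot : ∀ c ∈ crossings, c.top ≠ c.bot
  disjoint : ∀ c ∈ crossings, ∀ d ∈ crossings, c ≠ d →
    c.top ≠ d.top ∧ c.top ≠ d.bot ∧ c.bot ≠ d.bot

namespace GaussCode

variable {n : ℕ} (G : GaussCode n)

/-- `x` is not on a crossing. -/
def IsPlain (x : Fin n) : Prop := ∀ c ∈ G.crossings, x ≠ c.top ∧ x ≠ c.bot

/-- The components of the link: the cycles of `next`. -/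
def Component : Type := Quot fun x y : Fin n => G.next x = y

/-- The connected pieces of the diagram, seen as a graph in the sphere. -/
def Piece : Type := Quot fun x y : Fin n =>
  G.next x = y ∨ ∃ c ∈ G.crossings, x = c.top ∧ y = c.bot

/-- Walking along the boundary of a region with the region on the left. `(x, true)` is the edge
from `x` to `next x` walked forwards, `(x, false)` is the same edge walked backwards. At a vertex
the walk continues on the next edge in clockwise order. Counterclockwise, the edges at a crossing
are over-out, under-out, over-in, under-in if it is positive, and over-out, under-in, over-in,
under-out if it is negative. -/
inductive FaceStep : Fin n × Bool → Fin n × Bool → Prop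
  | plain_forward (w x : Fin n) (hx : G.IsPlain x) (hw : G.next w = x) :
      FaceStep (w, true) (x, true)
  | plain_backward (w x : Fin n) (hx : G.IsPlain x) (hw : G.next w = x) :
      FaceStep (x, false) (w, false)
  | pos_over_in (c : Crossing n) (hc : c ∈ G.crossings) (hs : c.sign = 1) (w : Fin n)
      (hw : G.next w = c.top) : FaceStep (w, true) (c.bot, true)
  | pos_under_in (c : Crossing n) (hc : c ∈ G.crossings) (hs : c.sign = 1) (v w : Fin n)
      (hv : G.next v = c.bot) (hw : G.next w = c.top) : FaceStep (v, true) (w, false)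
  | pos_over_out (c : Crossing n) (hc : c ∈ G.crossings) (hs : c.sign = 1) (v : Fin n)
      (hv : G.next v = c.bot) : FaceStep (c.top, false) (v, false)
  | pos_under_out (c : Crossing n) (hc : c ∈ G.crossings) (hs : c.sign = 1) :
      FaceStep (c.bot, false) (c.top, true)
  | neg_over_in (c : Crossing n) (hc : c ∈ G.crossings) (hs : c.sign = -1) (v w : Fin n)
      (hv : G.next v = c.bot) (hw : G.next w = c.top) : FaceStep (w, true) (v, false)
  | neg_under_in (c : Crossing n) (hc : c ∈ G.crossings) (hs : c.sign = -1) (v : Fin n)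
      (hv : G.next v = c.bot) : FaceStep (v, true) (c.top, true)
  | neg_over_out (c : Crossing n) (hc : c ∈ G.crossings) (hs : c.sign = -1) :
      FaceStep (c.top, false) (c.bot, true)
  | neg_under_out (c : Crossing n) (hc : c ∈ G.crossings) (hs : c.sign = -1) (w : Fin n)
      (hw : G.next w = c.top) : FaceStep (c.bot, false) (w, false)

/-- The regions of the diagram on the closed oriented surface that it determines. -/
def Face : Type := Quot G.FaceStep

/-- Every connected piece has genus zero, by Euler's formula `V - E + F = 2 C` with
`V = n - (number of crossings)` and `E = n`. -/
def IsPlanar : Prop := Nat.card G.Face = G.crossings.card + 2 * Nat.card G.Piece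

/-- The arcs: two consecutive edges belong to the same arc unless they are separated by an
undercrossing. -/
def Arc : Type := Quot fun w x : Fin n => G.next w = x ∧ ∀ c ∈ G.crossings, x ≠ c.bot

instance : Finite G.Arc := inferInstanceAs (Finite (Quot _))

instance : Fintype G.Arc := Fintype.ofFinite _

/-- The arc that contains the edge from `x` to `next x`. -/
def arc (x : Fin n) : G.Arc := Quot.mk _ x

/-- The component that contains the point `x`. -/
def component (x : Fin n) : G.Component := Quot.mk _ x

/-- The component that contains an arc. -/
def arcComponent : G.Arc → G.Component :=
  Quot.lift G.component fun _ _ h => Quot.sound h.1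

/-- The over-arc at a crossing. -/
def overArc (c : Crossing n) : G.Arc := G.arc c.top

/-- The incoming under-arc at a crossing. -/
def inArc (c : Crossing n) : G.Arc := G.arc (G.next.symm c.bot)

/-- The outgoing under-arc at a crossing. -/
def outArc (c : Crossing n) : G.Arc := G.arc c.bot

/-- The operation `x * y = m x + (1 - m) y` of the linear Alexander quandle on `ℤ/k`. -/
def alexanderOp (k : ℕ) (m : ℤ) (x y : ZMod k) : ZMod k := (m : ZMod k) * x + (1 - (m : ZMod k)) * y

/-- `(k, m)`-colorings of the diagram: with `x`, `z` the colors of the incoming and outgoing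
under-arcs and `y` the color of the over-arc, `z = x * y` at a positive crossing, and
`z = x *⁻¹ y`, that is `x = z * y`, at a negative one. -/
def IsColoring (k : ℕ) (m : ℤ) (C : G.Arc → ZMod k) : Prop :=
  ∀ c ∈ G.crossings,
    (c.sign = 1 → C (G.outArc c) = alexanderOp k m (C (G.inArc c)) (C (G.overArc c))) ∧
    (c.sign = -1 → C (G.inArc c) = alexanderOp k m (C (G.outArc c)) (C (G.overArc c)))

/-- Nontrivial (that is, nonconstant) `(k, m)`-colorings. -/
def IsNontrivialColoring (k : ℕ) (m : ℤ) (C : G.Arc → ZMod k) : Prop :=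
  G.IsColoring k m C ∧ ∃ a b, C a ≠ C b

open Classical in
/-- The Alexander matrix in the variables `t_i`, one for each component. Its rows are the
crossings, its columns are the arcs. If the over-arc `y` lies in component `i` and the under-arcs
in component `j`, the row reads `t_i x + (1 - t_j) y - z` with `x` the incoming and `z` the outgoing
under-arc at a positive crossing, and with `x` and `z` exchanged at a negative one (the Fox
derivatives of the Wirtinger relations). With all `t_i = t` it is the matrix of the coloring
conditions `t x + (1 - t) y - z = 0`. -/
def alexanderMatrix : Matrix G.crossings G.Arc (MvPolynomial G.Component ℤ) := fun c a =>
  (if a = (if c.1.sign = 1 then G.inArc c else G.outArc c) then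
      MvPolynomial.X (G.component c.1.top) else 0)
  + (if a = G.overArc c then 1 - MvPolynomial.X (G.component c.1.bot) else 0)
  - (if a = (if c.1.sign = 1 then G.outArc c else G.inArc c) then 1 else 0)

open Classical in
/-- The first minor of the Alexander matrix obtained by deleting the column `j` and keeping as
many rows as columns remain, selected by the injection `r` (if there are as many crossings as
arcs, this deletes one row). -/
def firstMinor (j : G.Arc) (r : {a : G.Arc // a ≠ j} ↪ G.crossings) : MvPolynomial G.Component ℤ :=
  Matrix.det fun a b : {a : G.Arc // a ≠ j} => G.alexanderMatrix (r a) b.1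

open Classical in
/-- `f` is the Alexander polynomial of the diagram in one variable `t_i` for each component, which
is defined up to multiplication by units `± t^v` of the Laurent polynomial ring. For a knot it is a
first minor of the Alexander matrix; with at least two components it is such a minor divided by
`t_i - 1`, with `i` the component of the arc whose column is deleted. It is zero if the matrix has
too few rows for a first minor. -/
def IsAlexanderPolynomial (f : MvPolynomial G.Component ℤ) : Prop :=
  (∃ (j : G.Arc) (r : {a : G.Arc // a ≠ j} ↪ G.crossings) (u v : G.Component →₀ ℕ) (s : ℤˣ),
    MvPolynomial.monomial u (s : ℤ) * G.firstMinor j r =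
      MvPolynomial.monomial v 1 *
        ((if Nat.card G.Component = 1 then 1 else MvPolynomial.X (G.arcComponent j) - 1) * f)) ∨
  ((∀ j : G.Arc, IsEmpty ({a : G.Arc // a ≠ j} ↪ G.crossings)) ∧ f = 0)

/-- `P` is the reduced Alexander polynomial of the diagram: set all variables of the Alexander
polynomial equal to `t` and normalize by a unit `± t^v` so that the constant term is positive
(unless the polynomial is zero). -/
def IsReducedAlexanderPolynomial (P : ℤ[X]) : Prop :=
  (∃ f, G.IsAlexanderPolynomial f ∧ ∃ (u v : ℕ) (s : ℤˣ),
    Polynomial.X ^ u * P =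
      Polynomial.C (s : ℤ) * Polynomial.X ^ v * MvPolynomial.aeval (fun _ => Polynomial.X) f) ∧
  (P ≠ 0 → 0 < P.coeff 0)

/-- `y` follows `x` on its strand if `ε = 1`, and `x` follows `y` if `ε = -1`. -/
def Adjacent (ε : ℤˣ) (x y : Fin n) : Prop :=
  (ε = 1 ∧ G.next x = y) ∨ (ε = -1 ∧ G.next y = x)

end GaussCode

/-- Oriented link diagrams with `n` marked points. -/
structure Diagram (n : ℕ) extends GaussCode n where
  pos : 0 < n
  planar : toGaussCode.IsPlanar

/-- The Reidemeister moves (in one direction each), the insertion of a 2-valent vertex on an edge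
and the renaming of the points. -/
inductive Move : (Σ n, Diagram n) → (Σ n, Diagram n) → Prop
  | rename {n : ℕ} (D D' : Diagram n) (e : Equiv.Perm (Fin n))
      (hnext : ∀ x, D'.next (e x) = e (D.next x))
      (hcross : D'.crossings = D.crossings.image fun c => ⟨e c.top, e c.bot, c.sign⟩) :
      Move ⟨n, D⟩ ⟨n, D'⟩
  /-- A new plain point `z` is put on an edge. -/
  | subdivide {n : ℕ} (D : Diagram n) (D' : Diagram (n + 1)) (e : Fin n ↪ Fin (n + 1))
      (z : Fin (n + 1)) (hz : ∀ x, e x ≠ z) (hzz : D'.next z ≠ z)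
      (hnext : ∀ x, D'.next (e x) = e (D.next x) ∨
        (D'.next (e x) = z ∧ D'.next z = e (D.next x)))
      (hcross : D'.crossings = D.crossings.image fun c => ⟨e c.top, e c.bot, c.sign⟩) :
      Move ⟨n, D⟩ ⟨n + 1, D'⟩
  /-- First Reidemeister move: a new kink, at two consecutive plain points. -/
  | reidemeister1 {n : ℕ} (D D' : Diagram n) (x y : Fin n) (s : ℤˣ)
      (hnext : D'.next = D.next)
      (hxy : D.next x = y ∨ D.next y = x)
      (hnew : ⟨x, y, s⟩ ∉ D.crossings)
      (hcross : D'.crossings = insert ⟨x, y, s⟩ D.crossings) :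
      Move ⟨n, D⟩ ⟨n, D'⟩
  /-- Second Reidemeister move: a new bigon, whose over-edge goes from `x` to `x'` and whose
  under-edge connects `y` and `y'`. The new crossings have opposite signs. That the two strands
  bound a common region before the move is expressed by the planarity of both diagrams. -/
  | reidemeister2 {n : ℕ} (D D' : Diagram n) (x x' y y' : Fin n) (s : ℤˣ)
      (hnext : D'.next = D.next)
      (hx : D.next x = x')
      (hy : D.next y = y' ∨ D.next y' = y)
      (hnew : ⟨x, y, s⟩ ∉ D.crossings) (hnew' : ⟨x', y', -s⟩ ∉ D.crossings)
      (hcross : D'.crossings = insert ⟨x, y, s⟩ (insert ⟨x', y', -s⟩ D.crossings)) :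
      Move ⟨n, D⟩ ⟨n, D'⟩
  /-- Third Reidemeister move, on a triangle between a top strand with points `t, t'`, a middle
  strand with points `m, m'` and a bottom strand with points `b, b'`. Before the move, top and middle
  cross at `(t, m)` with sign `s₁`, top and bottom at `(t', b)` with sign `s₂`, middle and bottom at
  `(m', b')` with sign `s₃`. After it, the order of the two crossings on each of the strands is
  reversed. The three edges bound a triangular region if and only if, up to a common sign `ε`, the
  direction of each edge is given by the sign of the opposite crossing. -/
  | reidemeister3 {n : ℕ} (D D' : Diagram n) (t t' m m' b b' : Fin n) (s₁ s₂ s₃ ε : ℤˣ)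
      (S : Finset (Crossing n))
      (hnext : D'.next = D.next)
      (hdistinct : [t, t', m, m', b, b'].Nodup)
      (ht : D.Adjacent (ε * s₃) t t') (hm : D.Adjacent (ε * s₂) m m')
      (hb : D.Adjacent (ε * s₁) b b')
      (hcross : D.crossings = S ∪ {⟨t, m, s₁⟩, ⟨t', b, s₂⟩, ⟨m', b', s₃⟩})
      (hcross' : D'.crossings = S ∪ {⟨t', m', s₁⟩, ⟨t, b', s₂⟩, ⟨m, b, s₃⟩}) :
      Move ⟨n, D⟩ ⟨n, D'⟩

/-- Oriented links: classes of diagrams modulo the equivalence relation generated by the moves. -/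
def Link : Type := Quot Move

namespace Link

variable (L : Link)

/-- `D` is a diagram of the link. -/
def HasDiagram {n : ℕ} (D : Diagram n) : Prop := Quot.mk Move ⟨n, D⟩ = L

/-- `P` is the reduced Alexander polynomial of the link. -/
def IsReducedAlexanderPolynomial (P : ℤ[X]) : Prop :=
  ∃ (n : ℕ) (D : Diagram n), L.HasDiagram D ∧ D.IsReducedAlexanderPolynomial P

/-- The link admits nontrivial `(k, m)`-colorings. -/
def AdmitsNontrivialColoring (k : ℕ) (m : ℤ) : Prop :=
  ∃ (n : ℕ) (D : Diagram n) (C : D.Arc → ZMod k), L.HasDiagram D ∧ D.IsNontrivialColoring k m C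

/-- The minimum number of colors in a nontrivial `(k, m)`-coloring, over all diagrams of the link
and all nontrivial `(k, m)`-colorings of these diagrams. -/
def mincol (k : ℕ) (m : ℤ) : ℕ :=
  sInf {q | ∃ (n : ℕ) (D : Diagram n) (C : D.Arc → ZMod k),
    L.HasDiagram D ∧ D.IsNontrivialColoring k m C ∧ q = (Set.range C).ncard}

end Link

end LinkTheory

end

noncomputable section

namespace LinkTheory

open Matrix

/-! ### Determinants of incidence-like integer matrices -/

/-! Take a diagram and a nontrivial `(p,m)`-coloring `C` that uses the minimal number `q` of colors.
Since `Δ(m) ≠ 0`, some first minor of the Alexander matrix of some diagram of the link is nonzero at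
`t = m`, so over `ℚ` the coloring equations with parameter `m` have only constant solutions there.
This property is a link invariant, so it also holds for the chosen diagram
(`Link.hasOnlyConstantColorings_iff`).

In the integer coefficient matrix, add up the columns of arcs to which `C` gives the same color, and
delete one of the `q` resulting columns. Over `ℚ` the kernel is trivial, because a kernel vector
lifts to a coloring of the arcs; hence some minor `N` of size `q - 1` is nonzero. Modulo `p` the
colors themselves give a nonzero kernel vector, so `p ∣ N`.

Each row `m x + (1 - m) y - z` is a nonnegative combination, of total weight `M`, of two incidence
rows of a directed graph. Incidence matrices have minors `0, ±1`, so multilinearity gives `|N| ≤ M ^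
(q - 1)` (`abs_det_le_pow_of_incidence_combination`). Thus `p ≤ M ^ (q - 1)`
(`IsNontrivialColoring.le_pow`). Equality would force `M = p`, that is `m = p` or `m = 1 - p`, and
both are excluded; the strict inequality gives the bound. -/

open Classical in
/-- A vector which is a difference of two vectors, each of which is zero or a standard basis
vector: a row of the incidence matrix of a directed graph with one vertex deleted. -/
def IsIncidenceRow {ι : Type*} (w : ι → ℤ) : Prop :=
  ∃ u v : Option ι, ∀ j, w j = (if u = some j then 1 else 0) - (if v = some j then 1 else 0)

/-- Endpoints outside the range of `f` become the deleted vertex `none`. This covers both passing to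
minors and reindexing. -/
theorem IsIncidenceRow.comp {ι κ : Type*} {w : ι → ℤ}
    (hw : IsIncidenceRow w) {f : κ → ι} (hf : Function.Injective f) :
    IsIncidenceRow (w ∘ f) := by
  have key : ∀ (u : Option ι) (j : κ),
      u.bind (Function.partialInv f) = some j ↔ u = some (f j) := by
    intro u j
    rw [Option.bind_eq_some_iff]
    constructor
    · rintro ⟨y, rfl, hy⟩
      rw [(hf.isPartialInv j y).1 hy]
    · rintro rfl
      exact ⟨_, rfl, Function.partialInv_left hf j⟩
  obtain ⟨u, v, h⟩ := hw
  refine ⟨u.bind (Function.partialInv f), v.bind (Function.partialInv f), fun j => ?_⟩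
  classical
  rw [Function.comp_apply, h]
  congr 1 <;> exact if_congr (key _ j).symm rfl rfl

/-- Poincaré's argument, by induction on the size: if all row sums vanish, the all-ones vector is in
the kernel; otherwise some row has at most one nonzero entry, equal to `±1`, and one expands along
it. -/
theorem abs_det_le_one_of_isIncidenceRow_fin :
    ∀ {n : ℕ} (A : Matrix (Fin n) (Fin n) ℤ), (∀ i, IsIncidenceRow (A i)) → |A.det| ≤ 1
  | 0, A, _ => by simp
  | n + 1, A, hA => by
    have hsub : ∀ i j, |(A.submatrix (Fin.succAbove i) (Fin.succAbove j)).det| ≤ 1 := fun i j =>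
      abs_det_le_one_of_isIncidenceRow_fin _ fun k =>
        (hA (i.succAbove k)).comp Fin.succAbove_right_injective
    have hone : ∀ (i k : Fin (n + 1)) (ε : ℤ), |ε| ≤ 1 →
        (∀ j, A i j = if k = j then ε else 0) → |A.det| ≤ 1 := by
      intro i k ε hε hi
      rw [det_succ_row A i]
      simp only [hi, mul_ite, ite_mul, mul_zero, zero_mul, Finset.sum_ite_eq, Finset.mem_univ,
        if_true, abs_mul, abs_pow, abs_neg, abs_one, one_pow, one_mul]
      exact mul_le_one₀ hε (abs_nonneg _) (hsub i k)
    by_cases hfull : ∀ i, ∑ j, A i j = 0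
    · have : A.det = 0 := by
        rw [← exists_mulVec_eq_zero_iff]
        refine ⟨fun _ => 1, fun h => one_ne_zero (congrFun h 0), funext fun i => ?_⟩
        simpa [mulVec, dotProduct] using hfull i
      simp [this]
    · push Not at hfull
      obtain ⟨i, hi⟩ := hfull
      obtain ⟨u, v, h⟩ := hA i
      rcases u with _ | k <;> rcases v with _ | l
      · exact hone i 0 0 (by simp) fun j => by simp [h]
      · exact hone i l (-1) (by simp) fun j => by simp [h, apply_ite]
      · exact hone i k 1 (by simp) fun j => by simp [h]
      · exact absurd (by simp [h]) hi

theorem abs_det_le_one_of_isIncidenceRow {ι : Type*} [Fintype ι] [DecidableEq ι]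
    (A : Matrix ι ι ℤ) (hA : ∀ i, IsIncidenceRow (A i)) : |A.det| ≤ 1 := by
  rw [← det_submatrix_equiv_self (Fintype.equivFin ι).symm A]
  exact abs_det_le_one_of_isIncidenceRow_fin _ fun i =>
    (hA _).comp (Fintype.equivFin ι).symm.injective

/-- If the rows of a matrix are combinations `a x + b y` of incidence rows with `a, b ≥ 0` and
`a + b = M`, then its determinant is at most `M ^ n`. -/
theorem abs_det_le_pow_of_incidence_combination {ι : Type*} [Fintype ι] [DecidableEq ι]
    (A : Matrix ι ι ℤ) (M : ℤ)
    (hA : ∀ i, ∃ (a b : ℤ) (x y : ι → ℤ), 0 ≤ a ∧ 0 ≤ b ∧ a + b = M ∧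
      IsIncidenceRow x ∧ IsIncidenceRow y ∧ A i = a • x + b • y) :
    |A.det| ≤ M ^ Fintype.card ι := by
  choose a b x y ha hb hab hx hy hAi using hA
  -- Expand by multilinearity: `s` is the set of rows in which the first summand is chosen. The same
  -- expansion of `∏ (a i + b i)` shows that the coefficients add up to `M ^ n`.
  have hdet : A.det = ∑ s : Finset ι,
      (∏ i, s.piecewise a b i) * det (s.piecewise x y : Matrix ι ι ℤ) := by
    have h := (detRowAlternating (R := ℤ) (n := ι)).toMultilinearMap.map_add_univ
      (fun i => a i • x i) (fun i => b i • y i)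
    have hA' : A = (fun i => a i • x i) + fun i => b i • y i := funext hAi
    rw [hA']
    refine h.trans (Finset.sum_congr rfl fun s _ => ?_)
    have hs : (s.piecewise (fun i => a i • x i) fun i => b i • y i) =
        fun i => s.piecewise a b i • (s.piecewise x y : ι → ι → ℤ) i := by
      funext i
      by_cases hi : i ∈ s <;> simp [hi]
    rw [hs]
    exact (detRowAlternating (R := ℤ) (n := ι)).toMultilinearMap.map_smul_univ _ _
  have hprod : M ^ Fintype.card ι = ∑ s : Finset ι, ∏ i, s.piecewise a b i := by
    have : M ^ Fintype.card ι = ∏ i, (a i + b i) := by simp [hab, Finset.card_univ]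
    rw [this, Finset.prod_add, Finset.powerset_univ]
    refine Finset.sum_congr rfl fun s _ => ?_
    rw [Finset.prod_piecewise, Finset.univ_inter]
  rw [hdet, hprod]
  refine (Finset.abs_sum_le_sum_abs _ _).trans (Finset.sum_le_sum fun s _ => ?_)
  have hnn : 0 ≤ ∏ i, s.piecewise a b i := Finset.prod_nonneg fun i _ => by
    by_cases hi : i ∈ s <;> simp [hi, ha, hb]
  rw [abs_mul, abs_of_nonneg hnn]
  refine mul_le_of_le_one_right hnn (abs_det_le_one_of_isIncidenceRow _ fun i => ?_)
  by_cases hi : i ∈ s <;> simp [hi, hx, hy]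

/-- A matrix with trivial kernel has a nonzero maximal minor. -/
theorem exists_det_submatrix_ne_zero {K r c : Type*} [Field K] [Fintype r] [Fintype c]
    [DecidableEq c] (A : Matrix r c K) (hA : ∀ v, A *ᵥ v = 0 → v = 0) :
    ∃ f : c → r, (A.submatrix f id).det ≠ 0 := by
  have hinj : Function.Injective A.mulVec :=
    (injective_iff_map_eq_zero A.mulVecLin).2 hA
  have hrank : Module.finrank K (Submodule.span K (Set.range A.row)) = Fintype.card c := by
    rw [← rank_eq_finrank_span_row, ← rank_transpose]
    exact LinearIndependent.rank_matrix (M := Aᵀ) (mulVec_injective_iff.1 hinj)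
  -- The row space has full dimension, and a basis of it can be chosen among the rows.
  obtain ⟨g, hg, -, hli⟩ := Submodule.exists_fun_fin_finrank_span_eq K (Set.range A.row)
  choose f hf using hg
  let e : c ≃ Fin (Module.finrank K (Submodule.span K (Set.range A.row))) :=
    Fintype.equivFinOfCardEq hrank.symm
  refine ⟨f ∘ e, ?_⟩
  have hrow : (A.submatrix (f ∘ e) id).row = g ∘ e := funext fun i => hf (e i)
  have := linearIndependent_rows_iff_isUnit.1 (hrow ▸ hli.comp e e.injective)
  exact ((isUnit_iff_isUnit_det _).1 this).ne_zero

namespace GaussCode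

/-! ### Linear colorings of the edges of a diagram over a field -/

variable {n : ℕ} {F : Type*} [Field F]

theorem eq_of_bot_eq (G : GaussCode n) {c d : Crossing n} (hc : c ∈ G.crossings)
    (hd : d ∈ G.crossings) (h : c.bot = d.bot) : c = d :=
  by_contra fun hcd => (G.disjoint c hc d hd hcd).2.2 h

theorem top_ne_bot' (G : GaussCode n) {c d : Crossing n} (hc : c ∈ G.crossings)
    (hd : d ∈ G.crossings) : c.top ≠ d.bot := by
  by_cases hcd : c = d
  · exact hcd ▸ G.top_ne_bot c hc
  · exact (G.disjoint c hc d hd hcd).2.1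

/-- The coefficient of the incoming under-strand at a crossing of a given sign, when the color of
the outgoing under-strand is computed. -/
def weight (m : F) (s : ℤˣ) : F := if s = 1 then m else m⁻¹

theorem weight_ne_zero {m : F} (hm : m ≠ 0) (s : ℤˣ) : weight m s ≠ 0 := by
  unfold weight; split_ifs <;> simp [hm]

theorem weight_neg (m : F) (s : ℤˣ) : weight m (-s) = (weight m s)⁻¹ := by
  rcases Int.units_eq_one_or s with rfl | rfl <;> simp [weight]

/-- Colorings of the edges by the linear Alexander quandle of a field. -/
def IsEdgeColoring (G : GaussCode n) (m : F) (f : Fin n → F) : Prop :=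
  ∀ w, ((∀ c ∈ G.crossings, G.next w ≠ c.bot) → f (G.next w) = f w) ∧
    ∀ c ∈ G.crossings, G.next w = c.bot →
      f c.bot = weight m c.sign * f w + (1 - weight m c.sign) * f c.top

/-- All edge colorings are constant. -/
def HasOnlyConstantColorings (G : GaussCode n) (m : F) : Prop :=
  ∀ f : Fin n → F, G.IsEdgeColoring m f → ∀ a b, f a = f b

/-! ### Edge colorings under renaming, subdivision and Reidemeister moves -/

theorem IsEdgeColoring.comp_rename {G G' : GaussCode n} {m : F} (e : Equiv.Perm (Fin n))
    (hnext : ∀ x, G'.next (e x) = e (G.next x))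
    (hcross : G'.crossings = G.crossings.image fun c => ⟨e c.top, e c.bot, c.sign⟩)
    {f : Fin n → F} (hf : G'.IsEdgeColoring m f) : G.IsEdgeColoring m (f ∘ e) := by
  intro w
  refine ⟨fun h => ?_, fun c hc hw => ?_⟩
  · have := (hf (e w)).1 (by
      rw [hcross, hnext]
      simpa using h)
    rwa [hnext] at this
  · exact (hf (e w)).2 ⟨e c.top, e c.bot, c.sign⟩ (hcross ▸ Finset.mem_image_of_mem _ hc)
      (by rw [hnext, hw])

theorem HasOnlyConstantColorings.rename {G G' : GaussCode n} {m : F} (e : Equiv.Perm (Fin n))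
    (hnext : ∀ x, G'.next (e x) = e (G.next x))
    (hcross : G'.crossings = G.crossings.image fun c => ⟨e c.top, e c.bot, c.sign⟩)
    (h : G.HasOnlyConstantColorings m) : G'.HasOnlyConstantColorings m := fun f hf a b => by
  simpa using h _ (hf.comp_rename e hnext hcross) (e.symm a) (e.symm b)

theorem hasOnlyConstantColorings_rename_iff {G G' : GaussCode n} {m : F}
    (e : Equiv.Perm (Fin n)) (hnext : ∀ x, G'.next (e x) = e (G.next x))
    (hcross : G'.crossings = G.crossings.image fun c => ⟨e c.top, e c.bot, c.sign⟩) :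
    G.HasOnlyConstantColorings m ↔ G'.HasOnlyConstantColorings m := by
  refine ⟨.rename e hnext hcross, .rename e.symm (fun x => ?_) ?_⟩
  · rw [Equiv.eq_symm_apply, ← hnext, Equiv.apply_symm_apply]
  · rw [hcross, Finset.image_image]
    ext c
    simp [Function.comp_def]

theorem hasOnlyConstantColorings_subdivide_iff {G : GaussCode n} {G' : GaussCode (n + 1)} {m : F}
    (e : Fin n ↪ Fin (n + 1)) (z : Fin (n + 1)) (hz : ∀ x, e x ≠ z) (hzz : G'.next z ≠ z)
    (hnext : ∀ x, G'.next (e x) = e (G.next x) ∨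
      (G'.next (e x) = z ∧ G'.next z = e (G.next x)))
    (hcross : G'.crossings = G.crossings.image fun c => ⟨e c.top, e c.bot, c.sign⟩) :
    G.HasOnlyConstantColorings m ↔ G'.HasOnlyConstantColorings m := by
  have hsurj : ∀ v, v ≠ z → ∃ x, e x = v := by
    intro v hv
    have huniv : insert z (Finset.univ.map e) = Finset.univ := by
      apply Finset.eq_univ_of_card
      rw [Finset.card_insert_of_notMem (by simpa using hz)]
      simp
    have := huniv ▸ Finset.mem_univ v
    simpa [hv] using this
  -- `x₀` is the subdivided edge; the new edge `z` must carry its color. It exists because `z` is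
  -- not a closed strand by itself.
  obtain ⟨x₀, hx₀⟩ : ∃ x, G'.next (e x) = z := by
    obtain ⟨x, hx⟩ := hsurj (G'.next.symm z) fun h => hzz (by
      conv_lhs => rw [← h]
      simp)
    exact ⟨x, by simp [hx]⟩
  have hz₀ : G'.next z = e (G.next x₀) := by
    rcases hnext x₀ with h | h
    · exact absurd (h.symm.trans hx₀) (hz _)
    · exact h.2
  have hbot : ∀ c ∈ G'.crossings, z ≠ c.bot := by
    rw [hcross]
    simpa using fun (c : Crossing n) _ => (hz c.bot).symm
  have hbot' : ∀ x, (∀ c ∈ G.crossings, x ≠ c.bot) → ∀ c ∈ G'.crossings, e x ≠ c.bot := by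
    intro x hx
    rw [hcross]
    simpa using hx
  have hmem : ∀ c ∈ G.crossings, (⟨e c.top, e c.bot, c.sign⟩ : Crossing (n + 1)) ∈ G'.crossings :=
    fun c hc => hcross ▸ Finset.mem_image_of_mem _ hc
  constructor
  · intro h f hf
    have hfz : f z = f (e x₀) := hx₀ ▸ (hf (e x₀)).1 (by rw [hx₀]; exact hbot)
    have hcol : G.IsEdgeColoring m (f ∘ e) := by
      intro w
      have hw : ∃ v, G'.next v = e (G.next w) ∧ f v = f (e w) := by
        rcases hnext w with h | h
        · exact ⟨_, h, rfl⟩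
        · exact ⟨z, h.2, by rw [hfz, e.injective (G'.next.injective (h.1.trans hx₀.symm))]⟩
      obtain ⟨v, hv, hfv⟩ := hw
      refine ⟨fun hb => ?_, fun c hc hb => ?_⟩
      · have := (hf v).1 (by rw [hv]; exact hbot' _ hb)
        rw [hv, hfv] at this
        exact this
      · have := (hf v).2 _ (hmem c hc) (by rw [hv, hb])
        rw [hfv] at this
        exact this
    have hall : ∀ a, f a = f (e x₀) := by
      intro a
      by_cases ha : a = z
      · rw [ha, hfz]
      · obtain ⟨x, rfl⟩ := hsurj a ha
        exact h _ hcol x x₀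
    intro a b
    rw [hall a, hall b]
  · intro h f hf
    let g : Fin (n + 1) → F := Function.extend e f fun _ => f x₀
    have hge : ∀ x, g (e x) = f x := fun x => e.injective.extend_apply _ _ x
    have hgz : g z = f x₀ := Function.extend_apply' _ _ _ fun ⟨x, hx⟩ => hz x hx
    have hcol : G'.IsEdgeColoring m g := by
      intro v
      by_cases hvz : G'.next v = z
      · have : v = e x₀ := G'.next.injective (hvz.trans hx₀.symm)
        refine ⟨fun _ => by rw [hvz, this, hge, hgz], fun c hc hb => ?_⟩
        exact absurd (hvz.symm.trans hb) (hbot c hc)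
      · obtain ⟨w, hw, hgw⟩ : ∃ w, G'.next v = e (G.next w) ∧ g v = f w := by
          by_cases hv : v = z
          · exact ⟨x₀, hv ▸ hz₀, hv ▸ hgz⟩
          · obtain ⟨w, rfl⟩ := hsurj v hv
            rcases hnext w with h | h
            · exact ⟨w, h, hge w⟩
            · exact absurd h.1 hvz
        rw [hw, hge, hgw]
        refine ⟨fun hb => (hf w).1 fun c hc hcw => hb _ (hmem c hc) (by rw [hcw]), fun c hc hb => ?_⟩
        rw [hcross, Finset.mem_image] at hc
        obtain ⟨d, hd, rfl⟩ := hc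
        simp only [hge]
        exact (hf w).2 d hd (e.injective hb)
    intro a b
    rw [← hge a, ← hge b]
    exact h g hcol _ _

/-- At a kink the over-strand has the color of one of the two under-strands, so the crossing
relation says that the under-strand keeps its color, as it does without the crossing. The colorings
are literally the same functions. -/
theorem isEdgeColoring_reidemeister1_iff {G G' : GaussCode n} {m : F} (hm : m ≠ 0) {x y : Fin n}
    {s : ℤˣ} (hnext : G'.next = G.next) (hxy : G.next x = y ∨ G.next y = x)
    (hnew : ⟨x, y, s⟩ ∉ G.crossings) (hcross : G'.crossings = insert ⟨x, y, s⟩ G.crossings)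
    (f : Fin n → F) : G.IsEdgeColoring m f ↔ G'.IsEdgeColoring m f := by
  have hmem : (⟨x, y, s⟩ : Crossing n) ∈ G'.crossings := by simp [hcross]
  have hsub : ∀ c ∈ G.crossings, c ∈ G'.crossings := fun c hc => by simp [hcross, hc]
  have hx : ∀ c ∈ G'.crossings, x ≠ c.bot := fun c hc => G'.top_ne_bot' hmem hc
  have hy : ∀ c ∈ G.crossings, y ≠ c.bot := fun c hc h =>
    hnew (G'.eq_of_bot_eq hmem (hsub c hc) h ▸ hc)
  have hxy' : ∀ f : Fin n → F, (G.next y = x → f x = f y) → ∀ w, G.next w = y →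
      (f y = f w ↔ f y = weight m s * f w + (1 - weight m s) * f x) := by
    intro f hfx w hw
    rcases hxy with h | h
    · obtain rfl : w = x := G.next.injective (hw.trans h.symm)
      constructor <;> intro h <;> linear_combination h
    · rw [hfx h]
      constructor
      · intro h; linear_combination weight m s * h
      · intro h
        apply mul_left_cancel₀ (weight_ne_zero hm s)
        linear_combination h
  constructor
  · intro hf w
    rw [hnext]
    refine ⟨fun h => (hf w).1 fun c hc => h c (hsub c hc), fun c hc hw => ?_⟩
    rw [hcross, Finset.mem_insert] at hc
    rcases hc with rfl | hc
    · exact (hxy' f (fun h => h ▸ (hf y).1 (by rw [h]; exact fun c hc => hx c (hsub c hc))) w hw).1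
        ((congrArg f hw).symm.trans ((hf w).1 (by rw [show G.next w = y from hw]; exact hy)))
    · exact (hf w).2 c hc hw
  · intro hf w
    unfold IsEdgeColoring at hf
    rw [hnext] at hf
    refine ⟨fun h => ?_, fun c hc hw => (hf w).2 c (hsub c hc) hw⟩
    by_cases hw : G.next w = y
    · rw [hw]
      exact (hxy' f (fun h => h ▸ (hf y).1 (by rw [h]; exact hx)) w hw).2 ((hf w).2 _ hmem hw)
    · refine (hf w).1 fun c hc => ?_
      rw [hcross, Finset.mem_insert] at hc
      rcases hc with rfl | hc
      · exact hw
      · exact h c hc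

/-- Only the under-edge `y` of the bigon changes color: the two crossings act with inverse weights,
so the color before `y` returns at `y'`. The over-edge may have either direction, so that reversing
the under-edge reduces to this case. -/
theorem hasOnlyConstantColorings_reidemeister2_aux {G G' : GaussCode n} {m : F} (hm : m ≠ 0)
    {x x' y y' : Fin n} {s : ℤˣ} (hnext : G'.next = G.next)
    (hx : G.next x = x' ∨ G.next x' = x) (hy : G.next y = y')
    (hnew : ⟨x, y, s⟩ ∉ G.crossings) (hnew' : ⟨x', y', -s⟩ ∉ G.crossings)
    (hcross : G'.crossings = insert ⟨x, y, s⟩ (insert ⟨x', y', -s⟩ G.crossings)) :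
    G.HasOnlyConstantColorings m ↔ G'.HasOnlyConstantColorings m := by
  have hmem : (⟨x, y, s⟩ : Crossing n) ∈ G'.crossings := by simp [hcross]
  have hmem' : (⟨x', y', -s⟩ : Crossing n) ∈ G'.crossings := by simp [hcross]
  have hsub : ∀ c ∈ G.crossings, c ∈ G'.crossings := fun c hc => by simp [hcross, hc]
  have hxb : ∀ c ∈ G'.crossings, x ≠ c.bot := fun c hc => G'.top_ne_bot' hmem hc
  have hxb' : ∀ c ∈ G'.crossings, x' ≠ c.bot := fun c hc => G'.top_ne_bot' hmem' hc
  have hyt : ∀ c ∈ G'.crossings, c.top ≠ y := fun c hc => G'.top_ne_bot' hc hmem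
  have hyb : ∀ c ∈ G.crossings, y ≠ c.bot := fun c hc h =>
    hnew (G'.eq_of_bot_eq hmem (hsub c hc) h ▸ hc)
  have hyb' : ∀ c ∈ G.crossings, y' ≠ c.bot := fun c hc h =>
    hnew' (G'.eq_of_bot_eq hmem' (hsub c hc) h ▸ hc)
  have hyy' : y' ≠ y := by
    intro h
    have : s = -s := congrArg Crossing.sign (G'.eq_of_bot_eq hmem hmem' h.symm)
    rcases Int.units_eq_one_or s with rfl | rfl <;> exact absurd this (by decide)
  obtain ⟨w₀, hw₀⟩ : ∃ w, G.next w = y := ⟨_, G.next.apply_symm_apply y⟩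
  have hw₀y : w₀ ≠ y := fun h => hyy' (by rw [← hy, ← h, hw₀, h])
  have hk := weight_ne_zero hm s
  have hxy : x ≠ y := hyt _ hmem
  have hxy' : x' ≠ y := hyt _ hmem'
  constructor
  · intro hG f hf
    unfold IsEdgeColoring at hf
    rw [hnext] at hf
    have hfx : f x = f x' := by
      rcases hx with h | h
      · exact ((congrArg f h).symm.trans ((hf x).1 (by rwa [h]))).symm
      · exact (congrArg f h).symm.trans ((hf x').1 (by rwa [h]))
    have h₁ : f y = weight m s * f w₀ + (1 - weight m s) * f x := (hf w₀).2 _ hmem hw₀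
    have h₂ : f y' = (weight m s)⁻¹ * f y + (1 - (weight m s)⁻¹) * f x' := by
      rw [← weight_neg]
      exact (hf y).2 _ hmem' hy
    have h₃ : f y' = f w₀ := by
      rw [h₂, h₁, hfx]
      field_simp
      ring
    let g := Function.update f y (f w₀)
    have hgy : g y = f w₀ := Function.update_self ..
    have hg : ∀ a, a ≠ y → g a = f a := fun a ha => Function.update_of_ne ha ..
    have hcol : G.IsEdgeColoring m g := by
      intro w
      by_cases hwy : w = y
      · subst hwy
        refine ⟨fun _ => ?_, fun c hc hw => absurd (hy.symm.trans hw) (hyb' c hc)⟩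
        rw [hy, hgy, hg _ hyy', h₃]
      · by_cases hw : G.next w = y
        · obtain rfl : w = w₀ := G.next.injective (hw.trans hw₀.symm)
          exact ⟨fun _ => by rw [hw, hgy, hg _ hwy], fun c hc h => absurd (hw.symm.trans h) (hyb c hc)⟩
        · refine ⟨fun h => ?_, fun c hc h => ?_⟩
          · rw [hg _ hw, hg _ hwy]
            refine (hf w).1 fun c hc => ?_
            rw [hcross, Finset.mem_insert, Finset.mem_insert] at hc
            rcases hc with rfl | rfl | hc
            · exact hw
            · exact fun h => hwy (G.next.injective (h.trans hy.symm))
            · exact h c hc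
          · rw [hg _ (hyb c hc).symm, hg _ hwy, hg _ (hyt c (hsub c hc))]
            exact (hf w).2 c (hsub c hc) h
    have hconst := hG g hcol
    have hall : ∀ a, f a = f x := by
      have h : ∀ a, a ≠ y → f a = f x := fun a ha => by rw [← hg a ha, ← hg x hxy]; exact hconst ..
      intro a
      by_cases ha : a = y
      · rw [ha, h₁, h w₀ hw₀y]; ring
      · exact h a ha
    intro a b
    rw [hall a, hall b]
  · intro hG f hf
    have hfx : f x = f x' := by
      rcases hx with h | h
      · exact ((congrArg f h).symm.trans
          ((hf x).1 (by rw [h]; exact fun c hc => hxb' c (hsub c hc)))).symm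
      · exact (congrArg f h).symm.trans
          ((hf x').1 (by rw [h]; exact fun c hc => hxb c (hsub c hc)))
    have h₁ : f y = f w₀ := (congrArg f hw₀).symm.trans ((hf w₀).1 (by rwa [hw₀]))
    have h₂ : f y' = f y := (congrArg f hy).symm.trans ((hf y).1 (by rwa [hy]))
    let v := weight m s * f w₀ + (1 - weight m s) * f x
    let g := Function.update f y v
    have hgy : g y = v := Function.update_self ..
    have hg : ∀ a, a ≠ y → g a = f a := fun a ha => Function.update_of_ne ha ..
    have hcol : G'.IsEdgeColoring m g := by
      intro w
      rw [hnext]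
      by_cases hwy : w = y
      · subst hwy
        refine ⟨fun h => absurd hy (h _ hmem'), fun c hc hw => ?_⟩
        obtain rfl := G'.eq_of_bot_eq hmem' hc (hy.symm.trans hw)
        simp only [hgy, hg _ hyy', hg _ hxy', weight_neg, ← hfx, h₂, h₁, v]
        field_simp
        ring
      · by_cases hw : G.next w = y
        · obtain rfl : w = w₀ := G.next.injective (hw.trans hw₀.symm)
          refine ⟨fun h => absurd hw (h _ hmem), fun c hc hw' => ?_⟩
          obtain rfl := G'.eq_of_bot_eq hmem hc (hw.symm.trans hw')
          simp only [hgy, hg _ hwy, hg _ hxy, v]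
        · refine ⟨fun h => ?_, fun c hc h => ?_⟩
          · rw [hg _ hw, hg _ hwy]
            exact (hf w).1 fun c hc => h c (hsub c hc)
          · rw [hcross, Finset.mem_insert, Finset.mem_insert] at hc
            rcases hc with rfl | rfl | hc
            · exact absurd h hw
            · exact absurd (G.next.injective (h.trans hy.symm)) hwy
            · rw [hg _ (hyb c hc).symm, hg _ hwy, hg _ (hyt c (hsub c hc))]
              exact (hf w).2 c hc h
    have hconst := hG g hcol
    have hall : ∀ a, f a = f w₀ := by
      intro a
      by_cases ha : a = y
      · rw [ha, h₁]
      · rw [← hg a ha, ← hg w₀ hw₀y]; exact hconst ..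
    intro a b
    rw [hall a, hall b]

theorem hasOnlyConstantColorings_reidemeister2_iff {G G' : GaussCode n} {m : F} (hm : m ≠ 0)
    {x x' y y' : Fin n} {s : ℤˣ} (hnext : G'.next = G.next) (hx : G.next x = x')
    (hy : G.next y = y' ∨ G.next y' = y)
    (hnew : ⟨x, y, s⟩ ∉ G.crossings) (hnew' : ⟨x', y', -s⟩ ∉ G.crossings)
    (hcross : G'.crossings = insert ⟨x, y, s⟩ (insert ⟨x', y', -s⟩ G.crossings)) :
    G.HasOnlyConstantColorings m ↔ G'.HasOnlyConstantColorings m := by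
  rcases hy with hy | hy
  · exact hasOnlyConstantColorings_reidemeister2_aux hm hnext (.inl hx) hy hnew hnew' hcross
  · exact hasOnlyConstantColorings_reidemeister2_aux (s := -s) hm hnext (.inr hx) hy hnew'
      (by rwa [neg_neg]) (by rw [neg_neg, hcross, Finset.insert_comm])

/-- The effect of the third Reidemeister move on colorings: the colors of the strands outside of
the triangle persist. -/
theorem IsEdgeColoring.reidemeister3 {G G' : GaussCode n} {k : F}
    {t t' m m' b b' : Fin n} {s₁ s₂ s₃ : ℤˣ} {S : Finset (Crossing n)}
    (hnext : G'.next = G.next)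
    (hcross : G.crossings = S ∪ {⟨t, m, s₁⟩, ⟨t', b, s₂⟩, ⟨m', b', s₃⟩})
    (hcross' : G'.crossings = S ∪ {⟨t', m', s₁⟩, ⟨t, b', s₂⟩, ⟨m, b, s₃⟩})
    (hdistinct : [t, t', m, m', b, b'].Nodup)
    {f g : Fin n → F} (hf : G.IsEdgeColoring k f)
    (hg : ∀ a, a ∉ [m, m', b, b'] → g a = f a)
    (hgw : ∀ w, G.next w ∉ [m, m', b, b'] → g w = f w)
    (hm : ∀ w, G.next w = m → g m = g w)
    (hm' : ∀ w, G.next w = m' → g m' = weight k s₁ * g w + (1 - weight k s₁) * g t')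
    (hb' : ∀ w, G.next w = b' → g b' = weight k s₂ * g w + (1 - weight k s₂) * g t)
    (hb : ∀ w, G.next w = b → g b = weight k s₃ * g w + (1 - weight k s₃) * g m) :
    G'.IsEdgeColoring k g := by
  have h₁ : (⟨t, m, s₁⟩ : Crossing n) ∈ G.crossings := by simp [hcross]
  have h₂ : (⟨t', b, s₂⟩ : Crossing n) ∈ G.crossings := by simp [hcross]
  have h₃ : (⟨m', b', s₃⟩ : Crossing n) ∈ G.crossings := by simp [hcross]
  have h₁' : (⟨t', m', s₁⟩ : Crossing n) ∈ G'.crossings := by simp [hcross']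
  have h₂' : (⟨t, b', s₂⟩ : Crossing n) ∈ G'.crossings := by simp [hcross']
  have h₃' : (⟨m, b, s₃⟩ : Crossing n) ∈ G'.crossings := by simp [hcross']
  have hS : ∀ c ∈ S, c ∈ G.crossings := fun c hc => by simp [hcross, hc]
  have hS' : ∀ c ∈ S, c ∈ G'.crossings := fun c hc => by simp [hcross', hc]
  -- A crossing of `S` ending at `b`, say, would equal both `⟨t', b, s₂⟩` and `⟨m, b, s₃⟩`,
  -- contradicting `t' ≠ m`.
  have hbot : ∀ c ∈ S, c.bot ∉ [m, m', b, b'] := by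
    intro c hc hmem
    simp only [List.mem_cons, List.not_mem_nil, or_false] at hmem
    rcases hmem with h | h | h | h
    · exact G'.top_ne_bot' h₃' (hS' c hc) h.symm
    · exact G.top_ne_bot' h₃ (hS c hc) h.symm
    · have e₁ := G.eq_of_bot_eq (hS c hc) h₂ h
      have e₂ := G'.eq_of_bot_eq (hS' c hc) h₃' h
      simp_all
    · have e₁ := G.eq_of_bot_eq (hS c hc) h₃ h
      have e₂ := G'.eq_of_bot_eq (hS' c hc) h₂' h
      simp_all
  have htop : ∀ c ∈ S, c.top ∉ [m, m', b, b'] := by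
    intro c hc hmem
    simp only [List.mem_cons, List.not_mem_nil, or_false] at hmem
    rcases hmem with h | h | h | h
    · exact G.top_ne_bot' (hS c hc) h₁ h
    · exact G'.top_ne_bot' (hS' c hc) h₁' h
    · exact G.top_ne_bot' (hS c hc) h₂ h
    · exact G.top_ne_bot' (hS c hc) h₃ h
  intro w
  rw [hnext]
  refine ⟨fun h => ?_, fun c hc hw => ?_⟩
  · by_cases hwm : G.next w = m
    · rw [hwm]; exact hm w hwm
    · have hnot : G.next w ∉ [m, m', b, b'] := by
        simp only [List.mem_cons, List.not_mem_nil, or_false, not_or]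
        exact ⟨hwm, h _ h₁', h _ h₃', h _ h₂'⟩
      rw [hg _ hnot, hgw _ hnot]
      refine (hf w).1 fun c hc hwc => ?_
      rw [hcross] at hc
      simp only [Finset.mem_union, Finset.mem_insert, Finset.mem_singleton] at hc
      rcases hc with hc | rfl | rfl | rfl
      · exact h c (hS' c hc) hwc
      all_goals exact hnot (by simp [hwc])
  · rw [hcross'] at hc
    simp only [Finset.mem_union, Finset.mem_insert, Finset.mem_singleton] at hc
    rcases hc with hc | rfl | rfl | rfl
    · rw [hg _ (hbot c hc), hg _ (htop c hc), hgw _ (hw ▸ hbot c hc)]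
      exact (hf w).2 c (hS c hc) hw
    · exact hm' w hw
    · exact hb' w hw
    · exact hb w hw

/-- In the third move, `ε * s₂` and `ε * s₁` are the directions of the middle and bottom edges:
equal directions give equal weights, opposite directions inverse ones. -/
theorem weight_eq_of_mul_eq (k : F) {s₁ s₂ ε d : ℤˣ} (h₁ : ε * s₁ = d) (h₂ : ε * s₂ = d) :
    weight k s₁ = weight k s₂ := by
  rw [mul_left_cancel (h₁.trans h₂.symm)]

theorem weight_eq_inv_of_mul_eq (k : F) {s₁ s₂ ε d : ℤˣ} (h₁ : ε * s₁ = d) (h₂ : ε * s₂ = -d) :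
    weight k s₁ = (weight k s₂)⁻¹ := by
  rw [← weight_neg]
  congr 1
  apply mul_left_cancel (a := ε)
  rw [h₁, mul_neg, h₂, neg_neg]

/-- Recoloring the inner middle edge `eM` and the inner bottom edge `eB` turns a coloring of `G`
into one of `G'`. If the latter is constant, the original is constant off these edges, and the
crossing relations force the two remaining colors. -/
theorem HasOnlyConstantColorings.of_reidemeister3 {G G' : GaussCode n} {k : F} (hk : k ≠ 0)
    {t t' m m' b b' : Fin n} {s₁ s₂ s₃ ε : ℤˣ} {S : Finset (Crossing n)}
    (hnext : G'.next = G.next)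
    (hdistinct : [t, t', m, m', b, b'].Nodup)
    (ht : G.Adjacent (ε * s₃) t t') (hm : G.Adjacent (ε * s₂) m m')
    (hb : G.Adjacent (ε * s₁) b b')
    (hcross : G.crossings = S ∪ {⟨t, m, s₁⟩, ⟨t', b, s₂⟩, ⟨m', b', s₃⟩})
    (hcross' : G'.crossings = S ∪ {⟨t', m', s₁⟩, ⟨t, b', s₂⟩, ⟨m, b, s₃⟩})
    (hG' : G'.HasOnlyConstantColorings k) : G.HasOnlyConstantColorings k := by
  intro f hf
  have h₁ : (⟨t, m, s₁⟩ : Crossing n) ∈ G.crossings := by simp [hcross]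
  have h₂ : (⟨t', b, s₂⟩ : Crossing n) ∈ G.crossings := by simp [hcross]
  have h₃ : (⟨m', b', s₃⟩ : Crossing n) ∈ G.crossings := by simp [hcross]
  have fm : ∀ w, G.next w = m → f m = weight k s₁ * f w + (1 - weight k s₁) * f t :=
    fun w hw => (hf w).2 _ h₁ hw
  have fb : ∀ w, G.next w = b → f b = weight k s₂ * f w + (1 - weight k s₂) * f t' :=
    fun w hw => (hf w).2 _ h₂ hw
  have fb' : ∀ w, G.next w = b' → f b' = weight k s₃ * f w + (1 - weight k s₃) * f m' :=
    fun w hw => (hf w).2 _ h₃ hw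
  have fm' : ∀ w, G.next w = m' → f m' = f w := fun w hw =>
    (congrArg f hw).symm.trans ((hf w).1 (by rw [hw]; exact fun c hc => G.top_ne_bot' h₃ hc))
  have ft : f t' = f t := by
    rcases ht with ⟨-, h⟩ | ⟨-, h⟩
    · exact (congrArg f h).symm.trans
        ((hf t).1 (by rw [h]; exact fun c hc => G.top_ne_bot' h₂ hc))
    · exact ((congrArg f h).symm.trans
        ((hf t').1 (by rw [h]; exact fun c hc => G.top_ne_bot' h₁ hc))).symm
  have hk₁ := weight_ne_zero hk s₁
  have hk₂ := weight_ne_zero hk s₂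
  have hinj : ∀ {u v w}, G.next u = w → G.next v = w → u = v := fun h h' =>
    G.next.injective (h.trans h'.symm)
  obtain ⟨wm, hwm⟩ : ∃ w, G.next w = m := ⟨_, G.next.apply_symm_apply m⟩
  obtain ⟨wm', hwm'⟩ : ∃ w, G.next w = m' := ⟨_, G.next.apply_symm_apply m'⟩
  obtain ⟨wb, hwb⟩ : ∃ w, G.next w = b := ⟨_, G.next.apply_symm_apply b⟩
  obtain ⟨wb', hwb'⟩ : ∃ w, G.next w = b' := ⟨_, G.next.apply_symm_apply b'⟩
  have hnd := hdistinct
  simp only [List.nodup_cons, List.mem_cons, List.not_mem_nil, or_false, not_or, not_false_eq_true,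
    List.nodup_nil, and_true] at hnd
  obtain ⟨⟨-, htm, htm', htb, htb'⟩, ⟨htm₁, htm₁', htb₁, htb₁'⟩, ⟨hmm', hmb, hmb'⟩,
    ⟨hmb₁, hmb₁'⟩, hbb'⟩ := hnd
  -- the colors of the two edges at the triangle which change
  have main : ∀ (eM eB : Fin n) (vM vB : F),
      (eM = m ∧ G.next m = m' ∨ eM = m' ∧ G.next m' = m) →
      (eB = b ∧ G.next b = b' ∨ eB = b' ∧ G.next b' = b) →
      (∀ g : Fin n → F, g eM = vM → g eB = vB → (∀ a, a ≠ eM → a ≠ eB → g a = f a) →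
        g m = g wm ∧ g m' = weight k s₁ * g wm' + (1 - weight k s₁) * g t' ∧
        g b' = weight k s₂ * g wb' + (1 - weight k s₂) * g t ∧
        g b = weight k s₃ * g wb + (1 - weight k s₃) * g m) →
      ∀ a b, f a = f b := by
    intro eM eB vM vB heM heB hall
    have hMB : eM ≠ eB := by
      rcases heM with ⟨rfl, -⟩ | ⟨rfl, -⟩ <;> rcases heB with ⟨rfl, -⟩ | ⟨rfl, -⟩ <;> assumption
    let g := Function.update (Function.update f eM vM) eB vB
    have hgB : g eB = vB := Function.update_self ..
    have hgM : g eM = vM := by simp [g, hMB]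
    have hgo : ∀ a, a ≠ eM → a ≠ eB → g a = f a := fun a h h' => by simp [g, h, h']
    obtain ⟨c₁, c₂, c₃, c₄⟩ := hall g hgM hgB hgo
    have hcol : G'.IsEdgeColoring k g := by
      refine hf.reidemeister3 hnext hcross hcross' hdistinct (fun a ha => ?_) (fun w hw => ?_)
        (fun w hw => hinj hw hwm ▸ c₁) (fun w hw => hinj hw hwm' ▸ c₂)
        (fun w hw => hinj hw hwb' ▸ c₃) (fun w hw => hinj hw hwb ▸ c₄)
      · simp only [List.mem_cons, List.not_mem_nil, or_false, not_or] at ha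
        apply hgo <;> grind
      · simp only [List.mem_cons, List.not_mem_nil, or_false, not_or] at hw
        apply hgo <;> grind
    have hconst := hG' g hcol
    have ho : ∀ a, a ≠ eM → a ≠ eB → f a = f t := fun a h h' => by
      rw [← hgo a h h', ← hgo t (by grind) (by grind)]
      exact hconst ..
    have hM : f m = f t ∧ f m' = f t := by
      rcases heM with ⟨rfl, h⟩ | ⟨rfl, h⟩
      · have e : f eM = f t := by
          rw [fm wm hwm, ho wm (by grind) (by grind)]
          ring
        exact ⟨e, (fm' _ h).trans e⟩
      · exact ⟨ho m hmm' (by grind), by rw [fm' wm' hwm', ho wm' (by grind) (by grind)]⟩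
    have hB : f b = f t ∧ f b' = f t := by
      rcases heB with ⟨rfl, h⟩ | ⟨rfl, h⟩
      · have e : f eB = f t := by
          rw [fb wb hwb, ft, ho wb (by grind) (by grind)]
          ring
        exact ⟨e, by rw [fb' _ h, hM.2, e]; ring⟩
      · have e : f eB = f t := by
          rw [fb' wb' hwb', hM.2, ho wb' (by grind) (by grind)]
          ring
        exact ⟨by rw [fb _ h, ft, e]; ring, e⟩
    have : ∀ a, f a = f t := by
      intro a
      by_cases h : a = eM
      · rcases heM with ⟨rfl, -⟩ | ⟨rfl, -⟩
        exacts [h ▸ hM.1, h ▸ hM.2]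
      · by_cases h' : a = eB
        · rcases heB with ⟨rfl, -⟩ | ⟨rfl, -⟩
          exacts [h' ▸ hB.1, h' ▸ hB.2]
        · exact ho a h h'
    intro a b
    rw [this a, this b]
  -- One case for each pair of directions. The only nontrivial identity left is self-distributivity
  -- of the linear operation, which needs the weights of `s₁` and `s₂` to be equal or inverse.
  rcases hm with ⟨hε₂, hm⟩ | ⟨hε₂, hm⟩ <;> rcases hb with ⟨hε₁, hb⟩ | ⟨hε₁, hb⟩
  · have hw := weight_eq_of_mul_eq k hε₁ hε₂
    obtain rfl : wm' = m := hinj hwm' hm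
    obtain rfl : wb' = b := hinj hwb' hb
    refine main wm' wb' (f wm) (weight k s₃ * f wb + (1 - weight k s₃) * f wm)
      (.inl ⟨rfl, hm⟩) (.inl ⟨rfl, hb⟩) fun g hgM hgB hgo => ?_
    rw [hgM, hgB, hgo wm (by grind) (by grind), hgo wb (by grind) (by grind), hgo m' (by grind)
      (by grind), hgo t' (by grind) (by grind), hgo t (by grind) (by grind),
      hgo b' (by grind) (by grind), fb' _ hb, fm' _ hm, fm _ hwm, fb _ hwb, ft, hw]
    refine ⟨rfl, rfl, by ring, rfl⟩
  · have hw := weight_eq_inv_of_mul_eq k hε₂ hε₁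
    obtain rfl : wm' = m := hinj hwm' hm
    obtain rfl : wb = b' := hinj hwb hb
    refine main wm' wb (f wm) (weight k s₂ * f wb' + (1 - weight k s₂) * f t)
      (.inl ⟨rfl, hm⟩) (.inr ⟨rfl, hb⟩) fun g hgM hgB hgo => ?_
    rw [hgM, hgB, hgo wm (by grind) (by grind), hgo wb' (by grind) (by grind), hgo m' (by grind)
      (by grind), hgo t' (by grind) (by grind), hgo t (by grind) (by grind),
      hgo b (by grind) (by grind), fb _ hb, fb' _ hwb', fm' _ hm, fm _ hwm, ft, hw]
    refine ⟨rfl, rfl, rfl, ?_⟩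
    field_simp
    ring
  · have hw := weight_eq_inv_of_mul_eq k hε₁ (by rw [hε₂])
    obtain rfl : wm = m' := hinj hwm hm
    obtain rfl : wb' = b := hinj hwb' hb
    refine main wm wb' (f m) (weight k s₃ * f wb + (1 - weight k s₃) * f m)
      (.inr ⟨rfl, hm⟩) (.inl ⟨rfl, hb⟩) fun g hgM hgB hgo => ?_
    rw [hgM, hgB, hgo wm' (by grind) (by grind), hgo wb (by grind) (by grind), hgo m (by grind)
      (by grind), hgo t' (by grind) (by grind), hgo t (by grind) (by grind),
      hgo b' (by grind) (by grind), fb' _ hb, fm _ hm, fm' _ hwm', fb _ hwb, ft, hw]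
    refine ⟨rfl, rfl, ?_, rfl⟩
    field_simp
    ring
  · have hw := weight_eq_of_mul_eq k hε₁ hε₂
    obtain rfl : wm = m' := hinj hwm hm
    obtain rfl : wb = b' := hinj hwb hb
    refine main wm wb (f m) (weight k s₂ * f wb' + (1 - weight k s₂) * f t)
      (.inr ⟨rfl, hm⟩) (.inr ⟨rfl, hb⟩) fun g hgM hgB hgo => ?_
    rw [hgM, hgB, hgo wm' (by grind) (by grind), hgo wb' (by grind) (by grind), hgo m (by grind)
      (by grind), hgo t' (by grind) (by grind), hgo t (by grind) (by grind),
      hgo b (by grind) (by grind), fb _ hb, fb' _ hwb', fm _ hm, fm' _ hwm', ft, hw]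
    refine ⟨rfl, rfl, rfl, by ring⟩

/-- The inverse move has the same form, with primed and unprimed points exchanged and `-ε` for `ε`.
-/
theorem hasOnlyConstantColorings_reidemeister3_iff {G G' : GaussCode n} {k : F} (hk : k ≠ 0)
    {t t' m m' b b' : Fin n} {s₁ s₂ s₃ ε : ℤˣ} {S : Finset (Crossing n)}
    (hnext : G'.next = G.next)
    (hdistinct : [t, t', m, m', b, b'].Nodup)
    (ht : G.Adjacent (ε * s₃) t t') (hm : G.Adjacent (ε * s₂) m m')
    (hb : G.Adjacent (ε * s₁) b b')
    (hcross : G.crossings = S ∪ {⟨t, m, s₁⟩, ⟨t', b, s₂⟩, ⟨m', b', s₃⟩})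
    (hcross' : G'.crossings = S ∪ {⟨t', m', s₁⟩, ⟨t, b', s₂⟩, ⟨m, b, s₃⟩}) :
    G.HasOnlyConstantColorings k ↔ G'.HasOnlyConstantColorings k := by
  have hswap : ∀ {δ : ℤˣ} {x y : Fin n}, G.Adjacent δ x y → G'.Adjacent (-δ) y x := by
    rintro δ x y (⟨rfl, h⟩ | ⟨rfl, h⟩)
    · exact .inr ⟨rfl, hnext ▸ h⟩
    · exact .inl ⟨neg_neg 1, hnext ▸ h⟩
  refine ⟨.of_reidemeister3 (ε := -ε) hk hnext.symm ?_ ?_ ?_ ?_ hcross' hcross,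
    .of_reidemeister3 hk hnext hdistinct ht hm hb hcross hcross'⟩
  · refine (List.Perm.nodup_iff ?_).1 hdistinct
    exact (List.Perm.swap ..).trans
      (((List.Perm.swap ..).trans (((List.Perm.swap ..).cons _).cons _) |>.cons _).cons _)
  all_goals rw [neg_mul]; exact hswap ‹_›

end GaussCode

/-- Having only constant colorings over a field is a link invariant. -/
theorem hasOnlyConstantColorings_of_move {F : Type*} [Field F] {k : F} (hk : k ≠ 0)
    {A B : Σ n, Diagram n} (h : Move A B) :
    A.2.HasOnlyConstantColorings k ↔ B.2.HasOnlyConstantColorings k := by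
  cases h with
  | rename D D' e hnext hcross =>
    exact GaussCode.hasOnlyConstantColorings_rename_iff e hnext hcross
  | subdivide D D' e z hz hzz hnext hcross =>
    exact GaussCode.hasOnlyConstantColorings_subdivide_iff e z hz hzz hnext hcross
  | reidemeister1 D D' x y s hnext hxy hnew hcross =>
    exact forall_congr' fun f => imp_congr_left
      (GaussCode.isEdgeColoring_reidemeister1_iff hk hnext hxy hnew hcross f)
  | reidemeister2 D D' x x' y y' s hnext hx hy hnew hnew' hcross =>
    exact GaussCode.hasOnlyConstantColorings_reidemeister2_iff hk hnext hx hy hnew hnew' hcross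
  | reidemeister3 D D' t t' m m' b b' s₁ s₂ s₃ ε S hnext hdistinct ht hm hb hcross hcross' =>
    exact GaussCode.hasOnlyConstantColorings_reidemeister3_iff hk hnext hdistinct ht hm hb hcross
      hcross'

theorem Link.hasOnlyConstantColorings_iff {F : Type*} [Field F] {k : F} (hk : k ≠ 0) {L : Link}
    {n n' : ℕ} {D : Diagram n} {D' : Diagram n'} (hD : L.HasDiagram D) (hD' : L.HasDiagram D') :
    D.HasOnlyConstantColorings k ↔ D'.HasOnlyConstantColorings k := by
  have h := congrArg (Quot.lift (fun A : Σ n, Diagram n => A.2.HasOnlyConstantColorings k)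
    fun _ _ h => propext (hasOnlyConstantColorings_of_move hk h))
    (Eq.trans hD (Eq.symm hD') : Quot.mk Move ⟨n, D⟩ = Quot.mk Move ⟨n', D'⟩)
  exact iff_of_eq h

/-! ### The rows of the coloring equations -/

open Classical in
/-- The coefficients of the coloring equation `m x + (1 - m) y - z = 0`. -/
def relationRow {R κ : Type*} [CommRing R] (m : R) (x y z b : κ) : R :=
  (if b = x then m else 0) + (if b = y then 1 - m else 0) - (if b = z then 1 else 0)

theorem relationRow_intCast {R κ : Type*} [CommRing R] (m : ℤ) (x y z b : κ) :
    ((relationRow m x y z b : ℤ) : R) = relationRow (m : R) x y z b := by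
  unfold relationRow
  push_cast
  rfl

open Classical in
-- The coefficients `m`, `1 - m`, `-1` add up to zero, so subtracting the constant `h j` changes
-- nothing and column `j` can be dropped.
theorem sum_relationRow_mul_sub {R κ : Type*} [CommRing R] [Fintype κ] (m : R) (x y z j : κ)
    [Fintype {b // b ≠ j}] (h : κ → R) :
    ∑ b : {b // b ≠ j}, relationRow m x y z b.1 * (h b.1 - h j) =
      m * h x + (1 - m) * h y - h z := by
  have hsub : ∑ b : {b // b ≠ j}, relationRow m x y z b.1 * (h b.1 - h j) =
      ∑ b, relationRow m x y z b * (h b - h j) := by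
    rw [← Finset.sum_erase Finset.univ (a := j) (by simp)]
    exact (Finset.sum_subtype _ (by simp) fun b => relationRow m x y z b * (h b - h j)).symm
  rw [hsub]
  simp only [relationRow, sub_mul, add_mul, ite_mul, zero_mul, one_mul, Finset.sum_sub_distrib,
    Finset.sum_add_distrib, Finset.sum_ite_eq', Finset.mem_univ, if_true]
  ring

open Classical in
theorem isIncidenceRow_sub_single {κ : Type*} (x y j : κ) :
    IsIncidenceRow fun b : {b // b ≠ j} =>
      (if b.1 = x then (1 : ℤ) else 0) - (if b.1 = y then 1 else 0) := by
  have : IsIncidenceRow fun b : κ => (if b = x then (1 : ℤ) else 0) - (if b = y then 1 else 0) :=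
    ⟨some x, some y, fun b => by simp [eq_comm]⟩
  exact this.comp Subtype.val_injective

/-- For `m ≥ 1` the row is `(m - 1)(x - y) + (x - z)`; for `m ≤ 0` it is `(-m)(y - x) + (y - z)`.
The weights add up to `m` and `1 - m` respectively. -/
theorem relationRow_eq_incidence_combination {κ : Type*} (m : ℤ) (x y z j : κ) :
    ∃ (a b : ℤ) (u v : {b // b ≠ j} → ℤ), 0 ≤ a ∧ 0 ≤ b ∧ a + b = max |m| |m - 1| ∧
      IsIncidenceRow u ∧ IsIncidenceRow v ∧
      (fun b : {b // b ≠ j} => relationRow m x y z b.1) = a • u + b • v := by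
  rcases le_or_gt 1 m with hm | hm
  · refine ⟨m - 1, 1, _, _, by lia, by lia, ?_, isIncidenceRow_sub_single x y j,
      isIncidenceRow_sub_single x z j, ?_⟩
    · rw [abs_of_nonneg (by lia), abs_of_nonneg (by lia), max_eq_left (by lia)]
      ring
    · funext b
      simp only [relationRow, Pi.add_apply, Pi.smul_apply, smul_eq_mul]
      split_ifs <;> ring
  · refine ⟨-m, 1, _, _, by lia, by lia, ?_, isIncidenceRow_sub_single y x j,
      isIncidenceRow_sub_single y z j, ?_⟩
    · rw [abs_of_nonpos (by lia), abs_of_nonpos (by lia), max_eq_right (by lia)]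
      ring
    · funext b
      simp only [relationRow, Pi.add_apply, Pi.smul_apply, smul_eq_mul]
      split_ifs <;> ring

namespace GaussCode

variable {n : ℕ} {F : Type*} [Field F] (G : GaussCode n)

/-! ### Colorings of the arcs -/

/-- The under-arc on the right of the over-strand of a crossing. -/
def sourceArc (c : Crossing n) : G.Arc := if c.sign = 1 then G.inArc c else G.outArc c

/-- The under-arc on the left of the over-strand of a crossing. -/
def targetArc (c : Crossing n) : G.Arc := if c.sign = 1 then G.outArc c else G.inArc c

/-- The coloring equations for the arcs. -/
def IsArcColoring {R : Type*} [CommRing R] (m : R) (h : G.Arc → R) : Prop :=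
  ∀ c ∈ G.crossings, m * h (G.sourceArc c) + (1 - m) * h (G.overArc c) - h (G.targetArc c) = 0

variable {G}

theorem arc_next {w : Fin n} (hw : ∀ c ∈ G.crossings, G.next w ≠ c.bot) :
    G.arc (G.next w) = G.arc w :=
  (Quot.sound ⟨rfl, hw⟩).symm

theorem relation_iff_weight {m : F} (hm : m ≠ 0) (h : G.Arc → F) (c : Crossing n) :
    m * h (G.sourceArc c) + (1 - m) * h (G.overArc c) - h (G.targetArc c) = 0 ↔
      h (G.arc c.bot) = weight m c.sign * h (G.arc (G.next.symm c.bot)) +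
        (1 - weight m c.sign) * h (G.arc c.top) := by
  rcases Int.units_eq_one_or c.sign with hs | hs <;>
    simp only [sourceArc, targetArc, weight, hs, overArc, inArc, outArc, if_true,
      show (-1 : ℤˣ) ≠ 1 by decide, if_false]
  · constructor <;> intro h <;> linear_combination -h
  · constructor
    · intro h
      field_simp
      linear_combination h
    · intro h
      rw [h]
      field_simp
      ring

theorem IsArcColoring.isEdgeColoring {m : F} (hm : m ≠ 0) {h : G.Arc → F}
    (hh : G.IsArcColoring m h) : G.IsEdgeColoring m fun x => h (G.arc x) := by
  refine fun w => ⟨fun hw => congrArg h (arc_next hw), fun c hc hw => ?_⟩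
  have h₁ := (relation_iff_weight hm h c).1 (hh c hc)
  rwa [← hw, Equiv.symm_apply_apply, hw] at h₁

theorem IsEdgeColoring.exists_isArcColoring {m : F} (hm : m ≠ 0) {f : Fin n → F}
    (hf : G.IsEdgeColoring m f) :
    ∃ h : G.Arc → F, G.IsArcColoring m h ∧ ∀ x, h (G.arc x) = f x := by
  refine ⟨Quot.lift f fun w x hwx => ?_, fun c hc => ?_, fun _ => rfl⟩
  · rw [← hwx.1]
    exact ((hf w).1 (by rw [hwx.1]; exact hwx.2)).symm
  · exact (relation_iff_weight hm _ c).2 ((hf _).2 c hc (Equiv.apply_symm_apply ..))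

theorem hasOnlyConstantColorings_iff_arc {m : F} (hm : m ≠ 0) :
    G.HasOnlyConstantColorings m ↔
      ∀ h : G.Arc → F, G.IsArcColoring m h → ∀ a b, h a = h b := by
  constructor
  · intro H h hh a b
    induction a using Quot.ind with | _ x
    induction b using Quot.ind with | _ y
    exact H _ (hh.isEdgeColoring hm) x y
  · intro H f hf a b
    obtain ⟨h, hh, hhf⟩ := hf.exists_isArcColoring hm
    rw [← hhf a, ← hhf b]
    exact H h hh _ _

theorem isColoring_iff_isArcColoring {k : ℕ} {m : ℤ} {C : G.Arc → ZMod k} :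
    G.IsColoring k m C ↔ G.IsArcColoring (m : ZMod k) C := by
  refine forall₂_congr fun c _ => ?_
  rcases Int.units_eq_one_or c.sign with hs | hs <;>
    simp [sourceArc, targetArc, hs, alexanderOp, show (-1 : ℤˣ) ≠ 1 by decide, sub_eq_zero,
      show (1 : ℤˣ) ≠ -1 by decide] <;> exact eq_comm

/-! ### The Alexander polynomial and rational colorings -/

theorem alexanderMatrix_eval (m : ℤ) (c : G.crossings) (a : G.Arc) :
    MvPolynomial.eval (fun _ => m) (G.alexanderMatrix c a) =
      relationRow m (G.sourceArc c) (G.overArc c) (G.targetArc c) a := by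
  simp only [alexanderMatrix, relationRow, sourceArc, targetArc, map_sub, map_add,
    apply_ite (MvPolynomial.eval fun _ => m), MvPolynomial.eval_X, map_one, map_zero]
  congr

theorem hasOnlyConstantColorings_of_firstMinor_eval_ne_zero {m : ℤ} (hm : m ≠ 0) (j : G.Arc)
    (r : {a : G.Arc // a ≠ j} ↪ G.crossings)
    (h : MvPolynomial.eval (fun _ => m) (G.firstMinor j r) ≠ 0) :
    G.HasOnlyConstantColorings (m : ℚ) := by
  classical
  rw [hasOnlyConstantColorings_iff_arc (by exact_mod_cast hm)]
  intro g hg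
  let N : Matrix {a : G.Arc // a ≠ j} {a : G.Arc // a ≠ j} ℤ := fun a b =>
    relationRow m (G.sourceArc (r a)) (G.overArc (r a)) (G.targetArc (r a)) b.1
  have hdet : N.det ≠ 0 := by
    convert h
    refine Eq.trans ?_ (RingHom.map_det (MvPolynomial.eval fun _ => m) _).symm
    congr 1
    ext a b
    exact (alexanderMatrix_eval m (r a) b.1).symm
  have hdet' : (N.map (Int.cast : ℤ → ℚ)).det ≠ 0 := by
    rw [← Int.cast_det]
    exact_mod_cast hdet
  have hker : N.map (Int.cast : ℤ → ℚ) *ᵥ (fun b => g b.1 - g j) = 0 := by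
    funext a
    exact (Finset.sum_congr rfl fun b _ =>
      congrArg (· * (g b.1 - g j)) (relationRow_intCast m _ _ _ b.1)).trans
        ((sum_relationRow_mul_sub ..).trans (hg _ (r a).2))
  have hz : (fun b : {a : G.Arc // a ≠ j} => g b.1 - g j) = 0 := by
    by_contra hne
    exact hdet' (exists_mulVec_eq_zero_iff.1 ⟨_, hne, hker⟩)
  have hall : ∀ a, g a = g j := fun a => by
    by_cases ha : a = j
    · rw [ha]
    · exact sub_eq_zero.1 (congrFun hz ⟨a, ha⟩)
  intro a b
  rw [hall a, hall b]

theorem IsReducedAlexanderPolynomial.hasOnlyConstantColorings {P : ℤ[X]}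
    (hP : G.IsReducedAlexanderPolynomial P) {m : ℤ} (hm0 : m ≠ 0) (hm1 : m ≠ 1)
    (hPm : P.eval m ≠ 0) : G.HasOnlyConstantColorings (m : ℚ) := by
  obtain ⟨⟨f, hf, u, v, s, hfP⟩, -⟩ := hP
  have hfm : MvPolynomial.eval (fun _ => m) f ≠ 0 := by
    intro h0
    have heval : Polynomial.eval m (MvPolynomial.aeval (fun _ => Polynomial.X) f) =
        MvPolynomial.eval (fun _ => m) f := by
      have : ((Polynomial.evalRingHom m).comp
          (MvPolynomial.aeval fun _ : G.Component => (Polynomial.X : ℤ[X])).toRingHom) =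
          MvPolynomial.eval fun _ => m := by
        apply MvPolynomial.ringHom_ext <;> simp
      exact congrArg (fun φ : MvPolynomial G.Component ℤ →+* ℤ => φ f) this
    have := congrArg (Polynomial.eval m) hfP
    rw [Polynomial.eval_mul, Polynomial.eval_mul, heval, h0, mul_zero, Polynomial.eval_pow,
      Polynomial.eval_X] at this
    exact mul_ne_zero (pow_ne_zero _ hm0) hPm this
  rcases hf with ⟨j, r, u', v', s', h⟩ | ⟨-, rfl⟩
  · refine hasOnlyConstantColorings_of_firstMinor_eval_ne_zero hm0 j r fun h0 => ?_
    have h := congrArg (MvPolynomial.eval fun _ => m) h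
    rw [map_mul, map_mul, map_mul, h0, mul_zero, MvPolynomial.eval_monomial, one_mul] at h
    -- Monomials do not vanish at `m ≠ 0`, nor does the factor `t_i - 1` at `m ≠ 1`.
    refine mul_ne_zero ?_ (mul_ne_zero ?_ hfm) h.symm
    · exact Finset.prod_ne_zero_iff.2 fun _ _ => pow_ne_zero _ hm0
    · split_ifs <;> simp [sub_eq_zero, hm1]
  · exact absurd (map_zero _) hfm

/-! ### The number of colors -/

theorem IsNontrivialColoring.le_pow {p : ℕ} [Fact p.Prime] {m : ℤ} (hm : m ≠ 0)
    {C : G.Arc → ZMod p} (hC : G.IsNontrivialColoring p m C)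
    (hG : G.HasOnlyConstantColorings (m : ℚ)) :
    (p : ℤ) ≤ max |m| |m - 1| ^ ((Set.range C).ncard - 1) := by
  classical
  obtain ⟨hcol, a₀, b₀, hab⟩ := hC
  rw [isColoring_iff_isArcColoring] at hcol
  rw [hasOnlyConstantColorings_iff_arc (by exact_mod_cast hm)] at hG
  -- Columns are indexed by the colors of `C`, not by arcs; the color `j` of `a₀` is the deleted
  -- column.
  let col : G.Arc → Set.range C := Set.rangeFactorization C
  let j := col a₀
  let ι := {b : Set.range C // b ≠ j}
  let row : G.crossings → ι → ℤ := fun c b =>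
    relationRow m (col (G.sourceArc c)) (col (G.overArc c)) (col (G.targetArc c)) b.1
  obtain ⟨r, hr⟩ := exists_det_submatrix_ne_zero
    (fun c b => (row c b : ℚ) : Matrix G.crossings ι ℚ) (by
      intro v hv
      -- Extended by `0` at `j`, a kernel vector pulls back along `col` to a rational arc coloring,
      -- hence a constant one, equal to `0`.
      let h : Set.range C → ℚ := fun b => if hb : b ≠ j then v ⟨b, hb⟩ else 0
      have hj : h j = 0 := by simp [h]
      have hb : ∀ b : ι, h b.1 = v b := fun b => dif_pos b.2
      have hh : G.IsArcColoring (m : ℚ) (h ∘ col) := by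
        intro c hc
        have := congrFun hv ⟨c, hc⟩
        simp only [mulVec, dotProduct, row, relationRow_intCast, Pi.zero_apply] at this
        simp only [Function.comp_apply]
        rw [← sum_relationRow_mul_sub _ _ _ _ j h, ← this]
        exact Finset.sum_congr rfl fun b _ => by rw [hj, sub_zero, hb]
      funext b
      obtain ⟨a, ha⟩ := Set.rangeFactorization_surjective (f := C) b.1
      have := hG _ hh a a₀
      rw [← hb b, ← ha]
      exact this.trans hj)
  let N : Matrix ι ι ℤ := fun i b => row (r i) b
  have hN : N.det ≠ 0 := by
    intro h0
    apply hr
    have := Int.cast_det (R := ℚ) N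
    rw [h0, Int.cast_zero] at this
    exact this.symm
  have hNp : (p : ℤ) ∣ N.det := by
    rw [← ZMod.intCast_zmod_eq_zero_iff_dvd, Int.cast_det, ← exists_mulVec_eq_zero_iff]
    -- The colors minus the color `j`: in the kernel because `C` is a coloring, nonzero because `C`
    -- takes a second value.
    refine ⟨fun b => (b.1 : ZMod p) - (j : ZMod p), fun h => ?_, funext fun i => ?_⟩
    · have hne : col b₀ ≠ j := fun h => hab (congrArg Subtype.val h).symm
      exact hab (sub_eq_zero.1 (congrFun h ⟨col b₀, hne⟩)).symm
    · exact (Finset.sum_congr rfl fun b _ =>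
        congrArg (· * ((b.1 : ZMod p) - (j : ZMod p))) (relationRow_intCast m _ _ _ b.1)).trans
          ((sum_relationRow_mul_sub _ _ _ _ j Subtype.val).trans (hcol _ (r i).2))
  have hcard : Fintype.card ι = (Set.range C).ncard - 1 := by
    rw [Fintype.card_subtype_compl, Fintype.card_subtype_eq, ← Nat.card_eq_fintype_card,
      Nat.card_coe_set_eq]
  rw [← hcard]
  refine (Int.le_of_dvd (abs_pos.2 hN) ((dvd_abs _ _).2 hNp)).trans ?_
  exact abs_det_le_pow_of_incidence_combination N _ fun i =>
    relationRow_eq_incidence_combination ..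

theorem IsNontrivialColoring.two_le_ncard {p : ℕ} [NeZero p] {m : ℤ} {C : G.Arc → ZMod p}
    (hC : G.IsNontrivialColoring p m C) : 2 ≤ (Set.range C).ncard := by
  obtain ⟨-, a, b, hab⟩ := hC
  exact (Set.one_lt_ncard_iff (Set.toFinite _)).2 ⟨_, _, ⟨a, rfl⟩, ⟨b, rfl⟩, hab⟩

end GaussCode

end LinkTheory

end

/-! ### The logarithmic lower bound -/

theorem mainTheorem2 (L : LinkTheory.Link) (Δ : Polynomial ℤ)
    (hΔ : L.IsReducedAlexanderPolynomial Δ) (hΔ0 : Δ ≠ 0)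
    (m : ℤ) (hm : Δ.eval m ≠ 0)
    (p : ℕ) (hp : p.Prime) (hpΔ : (p : ℤ) ∣ Δ.eval m) (hmp : IsCoprime m (p : ℤ))
    (hm1 : m ≠ 1) (hm1p : m ≠ 1 - (p : ℤ))
    (hcol : L.AdmitsNontrivialColoring p m) :
    2 + ⌊Real.logb ((max |m| |m - 1| : ℤ) : ℝ) (p : ℝ)⌋ ≤ (L.mincol p m : ℤ) := by
  have : Fact p.Prime := ⟨hp⟩
  have hm0 : m ≠ 0 := by
    rintro rfl
    rw [isCoprime_zero_left, Int.ofNat_isUnit, Nat.isUnit_iff] at hmp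
    exact hp.one_lt.ne' hmp
  have hmem : L.mincol p m ∈ {q | ∃ (n : ℕ) (D : LinkTheory.Diagram n) (C : D.Arc → ZMod p),
      L.HasDiagram D ∧ D.IsNontrivialColoring p m C ∧ q = (Set.range C).ncard} := by
    obtain ⟨n, D, C, hD, hC⟩ := hcol
    exact Nat.sInf_mem ⟨_, n, D, C, hD, hC, rfl⟩
  obtain ⟨n, D, C, hD, hC, hq⟩ := hmem
  obtain ⟨n₀, D₀, hD₀, hΔ₀⟩ := hΔ
  have hconst : D.HasOnlyConstantColorings (m : ℚ) :=
    (LinkTheory.Link.hasOnlyConstantColorings_iff (by exact_mod_cast hm0) hD₀ hD).1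
      (hΔ₀.hasOnlyConstantColorings hm0 hm1 hm)
  have hpow := hC.le_pow hm0 hconst
  have htwo := hC.two_le_ncard
  rw [← hq] at hpow htwo
  obtain ⟨q, hq'⟩ : ∃ q, L.mincol p m = q + 2 := ⟨_, (Nat.sub_add_cancel htwo).symm⟩
  rw [hq'] at hpow ⊢
  simp only [Nat.add_succ_sub_one] at hpow
  obtain ⟨M, hM⟩ : ∃ M : ℤ, M = max |m| |m - 1| := ⟨_, rfl⟩
  -- `M` is `m` for `m ≥ 1` and `1 - m` for `m ≤ 0`, so `M = p` means `m = p`, against coprimality,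
  -- or `m = 1 - p`.
  have hMp : M ≠ p := by
    intro h
    rcases le_or_gt 1 m with h1 | h1
    · rw [hM, abs_of_nonneg (by lia), abs_of_nonneg (by lia), max_eq_left (by lia)] at h
      rw [h, isCoprime_self, Int.ofNat_isUnit, Nat.isUnit_iff] at hmp
      exact hp.one_lt.ne' hmp
    · rw [hM, abs_of_nonpos (by lia), abs_of_nonpos (by lia), max_eq_right (by lia)] at h
      exact hm1p (by lia)
  have hM2 : 1 < M := by
    rw [hM, lt_max_iff, lt_abs, lt_abs]
    lia
  rw [← hM] at hpow ⊢
  -- A prime is not a proper power, so equality would leave only `M = p`. Strictness is what gives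
  -- the `2`, rather than `1`, in the bound.
  have hlt : (p : ℤ) < M ^ (q + 1) := by
    refine lt_of_le_of_ne hpow fun h => ?_
    have hprime : Prime (M ^ (q + 1)) := h ▸ Nat.prime_iff_prime_int.1 hp
    have hq0 : q + 1 = 1 := by
      by_contra hne
      exact not_prime_pow hne hprime
    rw [hq0, pow_one] at h
    exact hMp h.symm
  have hfloor : ⌊Real.logb (M : ℝ) (p : ℝ)⌋ < (q + 1 : ℤ) := by
    rw [Int.floor_lt, Real.logb_lt_iff_lt_rpow (by exact_mod_cast hM2)
      (by exact_mod_cast hp.pos)]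
    exact_mod_cast hlt
  push_cast
  lia
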